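/- Proposition 3.7. Let $n\ge 2$ be an integer. For an upper triangular real $n\times n$ matrix $M$ with rows and columns labelled $1,\dots,n$ and a set $I\subset\{1,\dots,n\}$, let $\Delta_I(M)$ be the minor of $M$ with rows $I$ and the last $|I|$ columns, and let $\Delta^I(M)$ be the minor with the first $|I|$ rows and columns $I$, where $\Delta_\emptyset=\Delta^\emptyset=1$. Let $N_n^+$ be the set of real upper triangular matrices $M$ with all diagonal entries $1$ such that every minor of $M$ that does not vanish identically on the group of invertible upper triangular real $n\times n$ matrices is positive. Write $[a,b]=\{i\in\mathbb N: a\le i\le b\}$ and $T_n=\{(a,b,c)\in\mathbb N^3: 1\le a<b<c\le n\}$. For $(a,b,c)\in T_n$ put (all minors being those of $M$) $$Y_{abc}(M)=\frac{\Delta_{[a,b-1]\cup[c+1,n]}\,\Delta_{[a+1,b]\cup[c,n]}}{\Delta_{[a,b]\cup[c+1,n]}\,\Delta_{[a+1,b-1]\cup[c,n]}},\qquad \tilde Y_{abc}(M)=\frac{\Delta_{[1,a]\cup[b+1,c-1]}\,\Delta_{[1,a-1]\cup[b,c]}}{\Delta_{[1,a]\cup[b,c-1]}\,\Delta_{[1,a-1]\cup[b+1,c]}},$$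 $$Y^{abc}(M)=\frac{\Delta^{[a,b]\cup[c+1,n]}\,\Delta^{[a+1,b-1]\cup[c,n]}}{\Delta^{[a,b-1]\cup[c+1,n]}\,\Delta^{[a+1,b]\cup[c,n]}},\qquad \tilde Y^{abc}(M)=\frac{\Delta^{[1,a]\cup[b,c-1]}\,\Delta^{[1,a-1]\cup[b+1,c]}}{\Delta^{[1,a]\cup[b+1,c-1]}\,\Delta^{[1,a-1]\cup[b,c]}}.$$ For $x>0$ let $l(x)=\frac{6}{\pi^2}L\bigl(\frac{x}{1+x}\bigr)$, where $L(x)=\sum_{k\ge1}\frac{x^k}{k^2}+\frac12\log x\,\log(1-x)$ for $0<x<1$ is the Rogers dilogarithm. Then for every $M\in N_n^+$ all the numbers $Y_{abc}(M)$, $\tilde Y^{abc}(M)$, $\tilde Y_{abc}(M)$, $Y^{abc}(M)$ with $(a,b,c)\in T_n$ are positive (so that $l$ is defined at them), and $$\sum_{(a,b,c)\in T_n} l\bigl(Y_{abc}(M)\bigr)=\sum_{(a,b,c)\in T_n} l\bigl(\tilde Y^{abc}(M)\bigr)=\sum_{(a,b,c)\in T_n} l\bigl(\tilde Y_{abc}(M)\bigr)=\sum_{(a,b,c)\in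 T_n} l\bigl(Y^{abc}(M)\bigr).$$ -/

import Mathlib

namespace TPDilog

open scoped BigOperators

noncomputable section

/-- The group `B_n` of real invertible upper triangular `n × n` matrices. -/
def IsInvUpper {n : ℕ} (G : Matrix (Fin n) (Fin n) ℝ) : Prop :=
  (∀ i j : Fin n, j < i → G i j = 0) ∧ IsUnit G.det

/-- The group `N_n` of upper unitriangular matrices inside `B_n`. -/
def IsUnipotentUpper {n : ℕ} (G : Matrix (Fin n) (Fin n) ℝ) : Prop :=
  IsInvUpper G ∧ ∀ i : Fin n, G i i = 1

/-- The minor of `G` with rows `r 0 < r 1 < ...` and columns `c 0 < c 1 < ...`. -/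
def minor {n k : ℕ} (G : Matrix (Fin n) (Fin n) ℝ) (r c : Fin k ↪o Fin n) : ℝ :=
  (G.submatrix r c).det

/-- The minor with rows `r` and columns `c` vanishes identically on `B_n`. -/
def VanishesIdentically {n k : ℕ} (r c : Fin k ↪o Fin n) : Prop :=
  ∀ H : Matrix (Fin n) (Fin n) ℝ, IsInvUpper H → minor H r c = 0

/-- `G ∈ B_n` is totally positive (with respect to `B_n`): every minor that does not vanish
identically on `B_n` is positive at `G`. -/
def IsTotallyPositive {n : ℕ} (G : Matrix (Fin n) (Fin n) ℝ) : Prop :=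
  IsInvUpper G ∧
    ∀ (k : ℕ) (r c : Fin k ↪o Fin n), ¬ VanishesIdentically r c → 0 < minor G r c

/-- `N_n^+`, the set of totally positive matrices in `N_n`. -/
def NPlus (n : ℕ) : Set (Matrix (Fin n) (Fin n) ℝ) :=
  {M | IsUnipotentUpper M ∧ IsTotallyPositive M}

/-- The increasing enumeration of the first `k` elements of `Fin n`. -/
def firstEmb {k n : ℕ} (h : k ≤ n) : Fin k ↪o Fin n :=
  OrderEmbedding.ofStrictMono (fun j => ⟨j.val, by omega⟩) (fun _ _ hij => hij)

/-- The increasing enumeration of the last `k` elements of `Fin n`. -/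
def lastEmb {k n : ℕ} (h : k ≤ n) : Fin k ↪o Fin n :=
  OrderEmbedding.ofStrictMono (fun j => ⟨n - k + j.val, by omega⟩)
    (fun _ _ hij => Nat.add_lt_add_left hij (n - k))

theorem card_le {n : ℕ} (I : Finset (Fin n)) : I.card ≤ n := by
  simpa using I.card_le_univ

/-- The right flag minor `Δ_I(G)`: rows `I`, last `|I|` columns (equal to `1` if `I = ∅`). -/
def rightMinor {n : ℕ} (G : Matrix (Fin n) (Fin n) ℝ) (I : Finset (Fin n)) : ℝ :=
  minor G (I.orderEmbOfFin rfl) (lastEmb (card_le I))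

/-- The upper flag minor `Δ^J(G)`: first `|J|` rows, columns `J` (equal to `1` if `J = ∅`). -/
def upperMinor {n : ℕ} (G : Matrix (Fin n) (Fin n) ℝ) (J : Finset (Fin n)) : ℝ :=
  minor G (firstEmb (card_le J)) (J.orderEmbOfFin rfl)

/-- The interval `[a,b] = {i | a ≤ i ≤ b}` of `{1,…,n}`. Rows and columns are labelled `1,…,n`:
the element `i : Fin n` carries the label `i + 1`. -/
def seg (n a b : ℕ) : Finset (Fin n) :=
  Finset.univ.filter (fun i => a ≤ i.val + 1 ∧ i.val + 1 ≤ b)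

/-- `Y_{abc}(M)`. -/
def YLow {n : ℕ} (M : Matrix (Fin n) (Fin n) ℝ) (a b c : ℕ) : ℝ :=
  (rightMinor M (seg n a (b - 1) ∪ seg n (c + 1) n) *
      rightMinor M (seg n (a + 1) b ∪ seg n c n)) /
    (rightMinor M (seg n a b ∪ seg n (c + 1) n) *
      rightMinor M (seg n (a + 1) (b - 1) ∪ seg n c n))

/-- `Ỹ_{abc}(M)`. -/
def YTildeLow {n : ℕ} (M : Matrix (Fin n) (Fin n) ℝ) (a b c : ℕ) : ℝ :=
  (rightMinor M (seg n 1 a ∪ seg n (b + 1) (c - 1)) *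
      rightMinor M (seg n 1 (a - 1) ∪ seg n b c)) /
    (rightMinor M (seg n 1 a ∪ seg n b (c - 1)) *
      rightMinor M (seg n 1 (a - 1) ∪ seg n (b + 1) c))

/-- `Y^{abc}(M)`. -/
def YUp {n : ℕ} (M : Matrix (Fin n) (Fin n) ℝ) (a b c : ℕ) : ℝ :=
  (upperMinor M (seg n a b ∪ seg n (c + 1) n) *
      upperMinor M (seg n (a + 1) (b - 1) ∪ seg n c n)) /
    (upperMinor M (seg n a (b - 1) ∪ seg n (c + 1) n) *
      upperMinor M (seg n (a + 1) b ∪ seg n c n))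

/-- `Ỹ^{abc}(M)`. -/
def YTildeUp {n : ℕ} (M : Matrix (Fin n) (Fin n) ℝ) (a b c : ℕ) : ℝ :=
  (upperMinor M (seg n 1 a ∪ seg n b (c - 1)) *
      upperMinor M (seg n 1 (a - 1) ∪ seg n (b + 1) c)) /
    (upperMinor M (seg n 1 a ∪ seg n (b + 1) (c - 1)) *
      upperMinor M (seg n 1 (a - 1) ∪ seg n b c))

/-- The discrete tetrahedron `T_n = {(a,b,c) | 1 ≤ a < b < c ≤ n}`. -/
def tetra (n : ℕ) : Finset (ℕ × ℕ × ℕ) :=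
  (Finset.Icc 1 n ×ˢ Finset.Icc 1 n ×ˢ Finset.Icc 1 n).filter
    (fun t => t.1 < t.2.1 ∧ t.2.1 < t.2.2)

/-- The dilogarithm `Li₂(x) = ∑_{k ≥ 1} x^k / k²` (the series converges for `|x| ≤ 1`). -/
def Li2 (x : ℝ) : ℝ := ∑' k : ℕ, x ^ (k + 1) / ((k : ℝ) + 1) ^ 2

/-- The Rogers dilogarithm, used for `0 < x < 1`. -/
def rogersL (x : ℝ) : ℝ := Li2 x + 1 / 2 * Real.log x * Real.log (1 - x)

/-- The function `l(x) = (6/π²) L(x/(1+x))`, used for `x > 0`. -/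
def ell (x : ℝ) : ℝ := 6 / Real.pi ^ 2 * rogersL (x / (1 + x))

end

end TPDilog

/-!
Each of the four families consists of ratios of the two summands in a three-term Plücker relation
among flag minors, or of the inverses of such ratios. A positive function on subsets of `{1, …, n}`
satisfying the three-term relations also satisfies the four-term ones, and the dilogarithms of the
ratios over `S` and over `S ∪ {d}` then differ by two five-term relations. Moving the base sets one
index at a time therefore carries `∑ l(Y_{abc})` to `∑ l(Ỹ_{abc})`, and likewise in the upper
family, because `l(x) + l(1/x)` is constant. Finally, `Y_{abc}` and `Ỹ^{a, a+c-b, c}` are the same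
ratio of minors with consecutive rows and columns, as both kinds of flag minor factor into such a
minor and a minor which cancels from the ratio.
-/

namespace TPDilog

/-! ### The five-term relation -/

theorem hasDerivAt_Li2 {x : ℝ} (h0 : 0 < x) (h1 : x < 1) :
    HasDerivAt Li2 (-Real.log (1 - x) / x) x := by
  obtain ⟨r, hxr, hr⟩ := exists_between h1
  have hr0 : 0 < r := h0.trans hxr
  have hterm : ∀ (k : ℕ) (y : ℝ),
      HasDerivAt (fun y : ℝ => y ^ (k + 1) / ((k : ℝ) + 1) ^ 2) (y ^ k / ((k : ℝ) + 1)) y := by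
    intro k y
    refine ((hasDerivAt_pow (k + 1) y).div_const (((k : ℝ) + 1) ^ 2)).congr_deriv ?_
    push_cast
    field_simp
  have hbound : ∀ (k : ℕ) (y : ℝ), y ∈ Metric.ball (0 : ℝ) r →
      ‖y ^ k / ((k : ℝ) + 1)‖ ≤ r ^ k := by
    intro k y hy
    have hyr : |y| ≤ r := by simpa using (Metric.mem_ball.1 hy).le
    rw [norm_div, norm_pow, Real.norm_eq_abs, Real.norm_of_nonneg (by positivity)]
    exact (div_le_self (by positivity) (by simp)).trans (by gcongr)
  have hsum := (Real.hasSum_pow_div_log_of_abs_lt_one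
    (by rwa [abs_of_pos h0] : |x| < 1)).div_const x
  have hderiv : HasDerivAt Li2 (∑' k : ℕ, x ^ k / ((k : ℝ) + 1)) x :=
    hasDerivAt_tsum_of_isPreconnected (summable_geometric_of_lt_one hr0.le hr) Metric.isOpen_ball
      (convex_ball (0 : ℝ) r).isPreconnected (fun k y _ => hterm k y) hbound
      (Metric.mem_ball_self hr0) (by simp)
      (by simpa [abs_of_pos h0] using hxr)
  refine hderiv.congr_deriv ?_
  rw [← hsum.tsum_eq]
  refine tsum_congr fun k => ?_
  rw [pow_succ]
  field_simp

theorem hasDerivAt_rogersL {x : ℝ} (h0 : 0 < x) (h1 : x < 1) :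
    HasDerivAt rogersL (-(Real.log (1 - x) / x + Real.log x / (1 - x)) / 2) x := by
  have h1x : 1 - x ≠ 0 := (sub_pos.2 h1).ne'
  have hlog : HasDerivAt (fun y : ℝ => Real.log (1 - y)) (-1 / (1 - x)) x :=
    ((hasDerivAt_id x).const_sub 1).log h1x
  refine ((hasDerivAt_Li2 h0 h1).add
    (((Real.hasDerivAt_log h0.ne').const_mul (1 / 2)).mul hlog)).congr_deriv ?_
  field_simp
  ring

theorem hasDerivAt_ell {x : ℝ} (hx : 0 < x) :
    HasDerivAt ell
      (3 / Real.pi ^ 2 * (Real.log (1 + x) / x - Real.log x / (1 + x))) x := by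
  have h1 : 0 < 1 + x := by positivity
  have hlt : x / (1 + x) < 1 := by rw [div_lt_one h1]; linarith
  have hmoebius : HasDerivAt (fun y : ℝ => y / (1 + y)) (1 / (1 + x) ^ 2) x := by
    refine ((hasDerivAt_id x).div ((hasDerivAt_id x).const_add 1) h1.ne').congr_deriv ?_
    simp
  have hcompl : 1 - x / (1 + x) = (1 + x)⁻¹ := by field_simp; ring
  refine (((hasDerivAt_rogersL (by positivity) hlt).comp x hmoebius).const_mul
    (6 / Real.pi ^ 2)).congr_deriv ?_
  rw [hcompl, Real.log_inv, Real.log_div hx.ne' h1.ne']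
  field_simp
  ring

/- In the coordinates `u = log x`, `v = log (1 + x)` the differential of `ℓ` is a multiple of
`v du - u dv`; this turns functional equations of `ℓ` into identities between `2 × 2` minors. -/
theorem hasDerivAt_ell_exp {u v : ℝ → ℝ} {u' v' t : ℝ} (hu : HasDerivAt u u' t)
    (hv : HasDerivAt v v' t) (huv : ∀ s, Real.exp (v s) = 1 + Real.exp (u s)) :
    HasDerivAt (fun s => ell (Real.exp (u s)))
      (3 / Real.pi ^ 2 * (v t * u' - u t * v')) t := by
  have hlog : Real.log (1 + Real.exp (u t)) = v t := by rw [← huv, Real.log_exp]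
  have hv' : Real.exp (v t) * v' = Real.exp (u t) * u' := by
    refine hv.exp.unique ?_
    simpa only [huv] using hu.exp.const_add 1
  have hquot : v' = Real.exp (u t) * u' / (1 + Real.exp (u t)) := by
    rw [← hv', ← huv, mul_div_cancel_left₀ _ (Real.exp_ne_zero _)]
  refine ((hasDerivAt_ell (Real.exp_pos (u t))).comp t hu.exp).congr_deriv ?_
  rw [hlog, Real.log_exp, hquot]
  field_simp

theorem eq_of_hasDerivAt_zero {f : ℝ → ℝ} (hf : ∀ t, HasDerivAt f 0 t) (s t : ℝ) : f s = f t :=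
  is_const_of_deriv_eq_zero (fun t => (hf t).differentiableAt) (fun t => (hf t).deriv) s t

theorem hasDerivAt_log_add_exp {y : ℝ} (hy : 0 < y) (t : ℝ) :
    HasDerivAt (fun s => Real.log (y + Real.exp s)) (Real.exp t / (y + Real.exp t)) t :=
  ((Real.hasDerivAt_exp t).const_add y).log (by positivity)

theorem ell_add_ell_inv {x : ℝ} (hx : 0 < x) : ell x + ell x⁻¹ = 2 * ell 1 := by
  set A : ℝ → ℝ := fun s => Real.log (1 + Real.exp s)
  have hexpA : ∀ s, Real.exp (A s) = 1 + Real.exp s := fun s => Real.exp_log (by positivity)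
  have hderiv : ∀ t, HasDerivAt (fun s => ell (Real.exp s) + ell (Real.exp (-s))) 0 t := by
    intro t
    have hA : HasDerivAt A _ t := hasDerivAt_log_add_exp one_pos t
    refine ((hasDerivAt_ell_exp (hasDerivAt_id' t) hA hexpA).add
      (hasDerivAt_ell_exp (hasDerivAt_neg t) (hA.fun_sub (hasDerivAt_id' t))
        fun s => ?_)).congr_deriv ?_
    · rw [Real.exp_sub, Real.exp_neg, hexpA]
      field_simp
      ring
    · ring
  simpa [Real.exp_neg, Real.exp_log hx, two_mul] using
    eq_of_hasDerivAt_zero hderiv (Real.log x) 0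

/-- The defect of the five-term relation for `ell` at the pair `(x, y)`. It vanishes identically,
but only its constancy is needed: the eight-term relations used for tetrahedral sums are
differences of two five-term relations. -/
noncomputable def fiveTermDefect (x y : ℝ) : ℝ :=
  ell x + ell y - (ell (x * y / (1 + x + y)) + ell (x / (1 + y)) + ell (y / (1 + x)))

theorem fiveTermDefect_comm (x y : ℝ) : fiveTermDefect x y = fiveTermDefect y x := by
  unfold fiveTermDefect
  rw [mul_comm x y, add_right_comm 1 x y]
  ring

theorem hasDerivAt_fiveTermDefect_exp {y : ℝ} (hy : 0 < y) (t : ℝ) :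
    HasDerivAt (fun s => fiveTermDefect (Real.exp s) y) 0 t := by
  set A : ℝ → ℝ := fun s => Real.log (1 + Real.exp s)
  set S : ℝ → ℝ := fun s => Real.log (1 + y + Real.exp s)
  set Y := Real.log y
  set B := Real.log (1 + y)
  have hexpA : ∀ s, Real.exp (A s) = 1 + Real.exp s := fun s => Real.exp_log (by positivity)
  have hexpS : ∀ s, Real.exp (S s) = 1 + y + Real.exp s := fun s => Real.exp_log (by positivity)
  have hexpY : Real.exp Y = y := Real.exp_log hy
  have hexpB : Real.exp B = 1 + y := Real.exp_log (by positivity)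
  have hxy : ∀ s, Real.exp (A s + B - S s) = 1 + Real.exp (s + Y - S s) := by
    intro s
    simp only [Real.exp_sub, Real.exp_add, hexpA, hexpS, hexpY, hexpB]
    field_simp
    ring
  have hxB : ∀ s, Real.exp (S s - B) = 1 + Real.exp (s - B) := by
    intro s
    rw [Real.exp_sub, Real.exp_sub, hexpS, hexpB]
    field_simp
  have hyA : ∀ s, Real.exp (S s - A s) = 1 + Real.exp (Y - A s) := by
    intro s
    rw [Real.exp_sub, Real.exp_sub, hexpS, hexpA, hexpY]
    field_simp
    ring
  have hcoord : (fun s => fiveTermDefect (Real.exp s) y) = fun s =>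
      ell (Real.exp s) + ell (Real.exp Y) -
        (ell (Real.exp (s + Y - S s)) + ell (Real.exp (s - B)) + ell (Real.exp (Y - A s))) := by
    funext s
    simp only [fiveTermDefect, Real.exp_sub, Real.exp_add, hexpA, hexpS, hexpY, hexpB,
      add_right_comm 1 (Real.exp s) y]
  have hX := hasDerivAt_id' t
  have hA : HasDerivAt A _ t := hasDerivAt_log_add_exp one_pos t
  have hS : HasDerivAt S _ t := hasDerivAt_log_add_exp (by positivity) t
  rw [hcoord]
  refine (((hasDerivAt_ell_exp hX hA hexpA).add_const (ell (Real.exp Y))).sub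
    (((hasDerivAt_ell_exp ((hX.add_const Y).fun_sub hS) ((hA.add_const B).fun_sub hS) hxy).add
      (hasDerivAt_ell_exp (hX.sub_const B) (hS.sub_const B) hxB)).add
      (hasDerivAt_ell_exp (hA.const_sub Y) (hS.fun_sub hA) hyA))).congr_deriv ?_
  ring

theorem fiveTermDefect_eq_left {x x' y : ℝ} (hx : 0 < x) (hx' : 0 < x') (hy : 0 < y) :
    fiveTermDefect x y = fiveTermDefect x' y := by
  simpa only [Real.exp_log hx, Real.exp_log hx'] using
    eq_of_hasDerivAt_zero (hasDerivAt_fiveTermDefect_exp hy) (Real.log x) (Real.log x')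

theorem fiveTermDefect_eq {x y x' y' : ℝ} (hx : 0 < x) (hy : 0 < y) (hx' : 0 < x')
    (hy' : 0 < y') : fiveTermDefect x y = fiveTermDefect x' y' := by
  rw [fiveTermDefect_eq_left hx hx' hy, fiveTermDefect_comm, fiveTermDefect_eq_left hy hy' hx',
    fiveTermDefect_comm]

/-! ### Positive flag functions and the eight-term relation -/

/-- A positive function on the subsets of `{1, …, n}` satisfying the three-term Plücker relations,
as the flag minors of a totally positive matrix do. Values at other finite subsets of `ℕ` carry no
information. -/
structure IsPositiveFlag (n : ℕ) (D : Finset ℕ → ℝ) : Prop where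
  pos : ∀ S, 0 < D S
  rel : ∀ S a b c, 1 ≤ a → a < b → b < c → c ≤ n → a ∉ S → b ∉ S → c ∉ S →
    D (insert a (insert c S)) * D (insert b S) =
      D (insert a (insert b S)) * D (insert c S) + D (insert b (insert c S)) * D (insert a S)

/-- The ratio of the two summands in the three-term Plücker relation for `a, b, c` over the base
set `S`. All four families of the theorem consist of such ratios or of their inverses. -/
noncomputable def crossY (D : Finset ℕ → ℝ) (S : Finset ℕ) (a b c : ℕ) : ℝ :=
  D (insert a S) * D (insert b (insert c S)) / (D (insert a (insert b S)) * D (insert c S))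

/-- The ratio of the two summands in the four-term Plücker relation for `a, b, c, d` over the base
set `S`. -/
noncomputable def crossZ (D : Finset ℕ → ℝ) (S : Finset ℕ) (a b c d : ℕ) : ℝ :=
  D (insert a (insert b S)) * D (insert c (insert d S)) /
    (D (insert a (insert d S)) * D (insert b (insert c S)))

namespace IsPositiveFlag

variable {n : ℕ} {D : Finset ℕ → ℝ} {S : Finset ℕ} {a b c d : ℕ}

theorem crossY_pos (hD : IsPositiveFlag n D) (S : Finset ℕ) (a b c : ℕ) : 0 < crossY D S a b c :=
  div_pos (mul_pos (hD.pos _) (hD.pos _)) (mul_pos (hD.pos _) (hD.pos _))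

theorem four_term (hD : IsPositiveFlag n D) (ha : 1 ≤ a) (hab : a < b) (hbc : b < c) (hcd : c < d)
    (hd : d ≤ n) (haS : a ∉ S) (hbS : b ∉ S) (hcS : c ∉ S) (hdS : d ∉ S) :
    D (insert a (insert c S)) * D (insert b (insert d S)) =
      D (insert a (insert b S)) * D (insert c (insert d S)) +
        D (insert a (insert d S)) * D (insert b (insert c S)) := by
  have habc := hD.rel S a b c ha hab hbc (hcd.le.trans hd) haS hbS hcS
  have hacd := hD.rel S a c d ha (hab.trans hbc) hcd hd haS hcS hdS
  have hbcd := hD.rel S b c d (ha.trans hab.le) hbc hcd hd hbS hcS hdS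
  refine mul_right_cancel₀ (hD.pos (insert c S)).ne' ?_
  linear_combination D (insert a (insert c S)) * hbcd +
    D (insert c (insert d S)) * habc - D (insert b (insert c S)) * hacd

theorem one_add_crossY (hD : IsPositiveFlag n D) (ha : 1 ≤ a) (hab : a < b) (hbc : b < c)
    (hc : c ≤ n) (haS : a ∉ S) (hbS : b ∉ S) (hcS : c ∉ S) :
    1 + crossY D S a b c =
      D (insert a (insert c S)) * D (insert b S) /
        (D (insert a (insert b S)) * D (insert c S)) := by
  have hne : ∀ T, D T ≠ 0 := fun T => (hD.pos T).ne'
  rw [hD.rel S a b c ha hab hbc hc haS hbS hcS, crossY, add_div,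
    div_self (mul_ne_zero (hne _) (hne _)), mul_comm (D (insert a S))]

theorem fiveTermDefect_crossY (hD : IsPositiveFlag n D) (ha : 1 ≤ a) (hab : a < b) (hbc : b < c)
    (hcd : c < d) (hd : d ≤ n) (haS : a ∉ S) (hbS : b ∉ S) (hcS : c ∉ S) (hdS : d ∉ S) :
    fiveTermDefect (crossY D S a b d) (crossY D S b c d) =
      ell (crossY D S a b d) + ell (crossY D S b c d) -
        (ell (crossY D S a c d) + ell (crossY D S a b c) + ell (crossZ D S a b c d)) := by
  have hne : ∀ T, D T ≠ 0 := fun T => (hD.pos T).ne'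
  have hx := hD.one_add_crossY ha hab (hbc.trans hcd) hd haS hbS hdS
  have hy := hD.one_add_crossY (ha.trans hab.le) hbc hcd hd hbS hcS hdS
  have hxy : 1 + crossY D S a b d + crossY D S b c d =
      D (insert a (insert c S)) * D (insert b (insert d S)) * D (insert b S) /
        (D (insert a (insert b S)) * D (insert b (insert c S)) * D (insert d S)) := by
    rw [hD.four_term ha hab hbc hcd hd haS hbS hcS hdS, hx, crossY]
    field_simp [hne]
    ring
  have hacd : crossY D S a b d * crossY D S b c d / (1 + crossY D S a b d + crossY D S b c d) =
      crossY D S a c d := by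
    rw [hxy]
    simp only [crossY]
    field_simp [hne]
  have habc : crossY D S a b d / (1 + crossY D S b c d) = crossY D S a b c := by
    rw [hy]
    simp only [crossY]
    field_simp [hne]
  have habcd : crossY D S b c d / (1 + crossY D S a b d) = crossZ D S a b c d := by
    rw [hx]
    simp only [crossY, crossZ]
    field_simp [hne]
  rw [fiveTermDefect, hacd, habc, habcd]

theorem fiveTermDefect_crossY_insert (hD : IsPositiveFlag n D) (ha : 1 ≤ a) (hab : a < b)
    (hbc : b < c) (hcd : c < d) (hd : d ≤ n) (haS : a ∉ S) (hbS : b ∉ S) (hcS : c ∉ S)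
    (hdS : d ∉ S) :
    fiveTermDefect (crossY D (insert c S) a b d) (crossY D (insert a S) b c d) =
      ell (crossY D (insert c S) a b d) + ell (crossY D (insert a S) b c d) -
        (ell (crossY D (insert b S) a c d) + ell (crossY D (insert d S) a b c) +
          ell (crossZ D S a b c d)) := by
  have hne : ∀ T, D T ≠ 0 := fun T => (hD.pos T).ne'
  have hx := hD.one_add_crossY (S := insert c S) ha hab (hbc.trans hcd) hd
    (by grind) (by grind) (by grind)
  have hy := hD.one_add_crossY (S := insert a S) (ha.trans hab.le) hbc hcd hd
    (by grind) (by grind) (by grind)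
  have hxy : 1 + crossY D (insert c S) a b d + crossY D (insert a S) b c d =
      D (insert a (insert c S)) * D (insert b (insert d S)) * D (insert a (insert c (insert d S))) /
        (D (insert a (insert b (insert c S))) * D (insert c (insert d S)) *
          D (insert a (insert d S))) := by
    rw [hD.four_term ha hab hbc hcd hd haS hbS hcS hdS, hx, crossY]
    simp only [Finset.insert_comm]
    field_simp [hne]
    ring
  have hacd : crossY D (insert c S) a b d * crossY D (insert a S) b c d /
      (1 + crossY D (insert c S) a b d + crossY D (insert a S) b c d) =
      crossY D (insert b S) a c d := by
    rw [hxy]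
    simp only [crossY, Finset.insert_comm]
    field_simp [hne]
  have habc : crossY D (insert c S) a b d / (1 + crossY D (insert a S) b c d) =
      crossY D (insert d S) a b c := by
    rw [hy]
    simp only [crossY, Finset.insert_comm]
    field_simp [hne]
  have habcd : crossY D (insert a S) b c d / (1 + crossY D (insert c S) a b d) =
      crossZ D S a b c d := by
    rw [hx]
    simp only [crossY, crossZ, Finset.insert_comm]
    field_simp [hne]
  rw [fiveTermDefect, hacd, habc, habcd]

theorem crossY_octagon (hD : IsPositiveFlag n D) (ha : 1 ≤ a) (hab : a < b) (hbc : b < c)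
    (hcd : c < d) (hd : d ≤ n) (haS : a ∉ S) (hbS : b ∉ S) (hcS : c ∉ S) (hdS : d ∉ S) :
    ell (crossY D (insert a S) b c d) + ell (crossY D S a c d) +
        ell (crossY D (insert c S) a b d) + ell (crossY D S a b c) =
      ell (crossY D S b c d) + ell (crossY D (insert b S) a c d) +
        ell (crossY D S a b d) + ell (crossY D (insert d S) a b c) := by
  have hdefect : fiveTermDefect (crossY D S a b d) (crossY D S b c d) =
      fiveTermDefect (crossY D (insert c S) a b d) (crossY D (insert a S) b c d) := by
    apply fiveTermDefect_eq <;> apply hD.crossY_pos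
  rw [hD.fiveTermDefect_crossY ha hab hbc hcd hd haS hbS hcS hdS,
    hD.fiveTermDefect_crossY_insert ha hab hbc hcd hd haS hbS hcS hdS] at hdefect
  linarith

end IsPositiveFlag

/-! ### Telescoping over the tetrahedron -/

theorem mem_tetra {n : ℕ} {t : ℕ × ℕ × ℕ} :
    t ∈ tetra n ↔ 1 ≤ t.1 ∧ t.1 < t.2.1 ∧ t.2.1 < t.2.2 ∧ t.2.2 ≤ n := by
  simp only [tetra, Finset.mem_filter, Finset.mem_product, Finset.mem_Icc]
  omega

/-- The increasing quadruples in `{1, …, n}`, encoded as a triple followed by its largest entry. -/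
def quads (n : ℕ) : Finset ((ℕ × ℕ × ℕ) × ℕ) :=
  (tetra n ×ˢ Finset.Icc 1 n).filter fun q => q.1.2.2 < q.2

theorem mem_quads {n : ℕ} {q : (ℕ × ℕ × ℕ) × ℕ} : q ∈ quads n ↔
    1 ≤ q.1.1 ∧ q.1.1 < q.1.2.1 ∧ q.1.2.1 < q.1.2.2 ∧ q.1.2.2 < q.2 ∧ q.2 ≤ n := by
  simp only [quads, Finset.mem_filter, Finset.mem_product, mem_tetra, Finset.mem_Icc]
  omega

theorem sum_tetra_sum_Icc {R : Type*} [AddCommMonoid R] (n : ℕ) (g : ℕ → ℕ → ℕ → ℕ → R)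
    (hg : ∀ a b c w, a < b → b < c → w = a ∨ w = b ∨ w = c → g a b c w = 0) :
    ∑ t ∈ tetra n, ∑ w ∈ Finset.Icc 1 n, g t.1 t.2.1 t.2.2 w =
      ∑ q ∈ quads n, (g q.1.2.1 q.1.2.2 q.2 q.1.1 + g q.1.1 q.1.2.2 q.2 q.1.2.1 +
          g q.1.1 q.1.2.1 q.2 q.1.2.2 + g q.1.1 q.1.2.1 q.1.2.2 q.2) := by
  rw [← Finset.sum_product (tetra n) (Finset.Icc 1 n) fun p => g p.1.1 p.1.2.1 p.1.2.2 p.2]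
  have hsplit : ∀ p ∈ tetra n ×ˢ Finset.Icc 1 n, g p.1.1 p.1.2.1 p.1.2.2 p.2 =
      (if p.2 < p.1.1 then g p.1.1 p.1.2.1 p.1.2.2 p.2 else 0) +
      (if p.1.1 < p.2 ∧ p.2 < p.1.2.1 then g p.1.1 p.1.2.1 p.1.2.2 p.2 else 0) +
      (if p.1.2.1 < p.2 ∧ p.2 < p.1.2.2 then g p.1.1 p.1.2.1 p.1.2.2 p.2 else 0) +
      (if p.1.2.2 < p.2 then g p.1.1 p.1.2.1 p.1.2.2 p.2 else 0) := by
    rintro ⟨⟨a, b, c⟩, w⟩ hp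
    obtain ⟨-, hab, hbc, -⟩ := mem_tetra.1 (Finset.mem_product.1 hp).1
    have hzero := hg a b c w hab hbc
    dsimp only at hab hbc ⊢
    split_ifs <;> first | omega | simp only [zero_add, add_zero]
    exact hzero (by omega)
  rw [Finset.sum_congr rfl hsplit]
  simp only [Finset.sum_add_distrib, ← Finset.sum_filter]
  refine congrArg₂ _ (congrArg₂ _ (congrArg₂ _ ?_ ?_) ?_) rfl
  · exact Finset.sum_nbij' (fun p => ((p.2, p.1.1, p.1.2.1), p.1.2.2))
      (fun q => ((q.1.2.1, q.1.2.2, q.2), q.1.1))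
      (by grind [mem_quads, mem_tetra]) (by grind [mem_quads, mem_tetra]) (by grind) (by grind)
      (by grind)
  · exact Finset.sum_nbij' (fun p => ((p.1.1, p.2, p.1.2.1), p.1.2.2))
      (fun q => ((q.1.1, q.1.2.2, q.2), q.1.2.1))
      (by grind [mem_quads, mem_tetra]) (by grind [mem_quads, mem_tetra]) (by grind) (by grind)
      (by grind)
  · exact Finset.sum_nbij' (fun p => ((p.1.1, p.1.2.1, p.2), p.1.2.2))
      (fun q => ((q.1.1, q.1.2.1, q.2), q.1.2.2))
      (by grind [mem_quads, mem_tetra]) (by grind [mem_quads, mem_tetra]) (by grind) (by grind)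
      (by grind)

/-- The base set that agrees with `[1, a) ∪ (b, c)` below `w` and with `(a, b) ∪ (c, n]` from `w`
on. Moving `w` from `1` to `n + 1` interpolates between the base sets of the two families of
variables attached to the same flag. -/
def stage (n a b c w : ℕ) : Finset ℕ :=
  (Finset.Ico 1 a ∪ Finset.Ioo b c).filter (· < w) ∪
    (Finset.Ioo a b ∪ Finset.Ioc c n).filter (w ≤ ·)

theorem mem_stage {n a b c w i : ℕ} : i ∈ stage n a b c w ↔
    (1 ≤ i ∧ i < a ∨ b < i ∧ i < c) ∧ i < w ∨ (a < i ∧ i < b ∨ c < i ∧ i ≤ n) ∧ w ≤ i := by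
  simp only [stage, Finset.mem_union, Finset.mem_filter, Finset.mem_Ico, Finset.mem_Ioo,
    Finset.mem_Ioc]

theorem stage_succ {n a b c w : ℕ} (hab : a < b) (hbc : b < c) (hw : w = a ∨ w = b ∨ w = c) :
    stage n a b c (w + 1) = stage n a b c w := by
  ext i
  rw [mem_stage, mem_stage]
  omega

theorem stage_one (n a b c : ℕ) : stage n a b c 1 = Finset.Ioo a b ∪ Finset.Ioc c n := by
  ext i
  simp only [mem_stage, Finset.mem_union, Finset.mem_Ioo, Finset.mem_Ioc]
  omega

theorem stage_last {n a b c : ℕ} (hab : a < b) (hbc : b < c) (hcn : c ≤ n) :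
    stage n a b c (n + 1) = Finset.Ico 1 a ∪ Finset.Ioo b c := by
  ext i
  simp only [mem_stage, Finset.mem_union, Finset.mem_Ioo, Finset.mem_Ico]
  omega

namespace IsPositiveFlag

variable {n : ℕ} {D : Finset ℕ → ℝ}

theorem sum_ell_stage_succ (hD : IsPositiveFlag n D) {a b c d : ℕ} (ha : 1 ≤ a)
    (hab : a < b) (hbc : b < c) (hcd : c < d) (hd : d ≤ n) :
    ell (crossY D (stage n b c d (a + 1)) b c d) + ell (crossY D (stage n a c d (b + 1)) a c d) +
        ell (crossY D (stage n a b d (c + 1)) a b d) +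
        ell (crossY D (stage n a b c (d + 1)) a b c) =
      ell (crossY D (stage n b c d a) b c d) + ell (crossY D (stage n a c d b) a c d) +
        ell (crossY D (stage n a b d c) a b d) + ell (crossY D (stage n a b c d) a b c) := by
  set S := (Finset.Icc 1 n).filter fun i => i < a ∨ b < i ∧ i < c ∨ d < i
  have hmem : ∀ i, i ∈ S ↔ (1 ≤ i ∧ i ≤ n) ∧ (i < a ∨ b < i ∧ i < c ∨ d < i) := by
    simp [S]
  have hbcd : stage n b c d a = S ∧ stage n b c d (a + 1) = insert a S := by
    constructor <;> ext i <;> simp only [Finset.mem_insert, mem_stage, hmem] <;> omega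
  have hacd : stage n a c d b = insert b S ∧ stage n a c d (b + 1) = S := by
    constructor <;> ext i <;> simp only [Finset.mem_insert, mem_stage, hmem] <;> omega
  have habd : stage n a b d c = S ∧ stage n a b d (c + 1) = insert c S := by
    constructor <;> ext i <;> simp only [Finset.mem_insert, mem_stage, hmem] <;> omega
  have habc : stage n a b c d = insert d S ∧ stage n a b c (d + 1) = S := by
    constructor <;> ext i <;> simp only [Finset.mem_insert, mem_stage, hmem] <;> omega
  rw [hbcd.1, hbcd.2, hacd.1, hacd.2, habd.1, habd.2, habc.1, habc.2]
  apply hD.crossY_octagon ha hab hbc hcd hd <;> rw [hmem] <;> omega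

theorem sum_ell_crossY (hD : IsPositiveFlag n D) :
    ∑ t ∈ tetra n,
        ell (crossY D (Finset.Ioo t.1 t.2.1 ∪ Finset.Ioc t.2.2 n) t.1 t.2.1 t.2.2) =
      ∑ t ∈ tetra n,
        ell (crossY D (Finset.Ico 1 t.1 ∪ Finset.Ioo t.2.1 t.2.2) t.1 t.2.1 t.2.2) := by
  set f : ℕ → ℕ → ℕ → ℕ → ℝ := fun a b c w => ell (crossY D (stage n a b c w) a b c)
  have htelescope : ∀ t ∈ tetra n,
      ∑ w ∈ Finset.Icc 1 n, (f t.1 t.2.1 t.2.2 (w + 1) - f t.1 t.2.1 t.2.2 w) =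
      ell (crossY D (Finset.Ico 1 t.1 ∪ Finset.Ioo t.2.1 t.2.2) t.1 t.2.1 t.2.2) -
        ell (crossY D (Finset.Ioo t.1 t.2.1 ∪ Finset.Ioc t.2.2 n) t.1 t.2.1 t.2.2) := by
    intro t ht
    obtain ⟨-, hab, hbc, hcn⟩ := mem_tetra.1 ht
    rw [← stage_one, ← stage_last hab hbc hcn, ← Finset.sum_Ico_sub (f t.1 t.2.1 t.2.2) (by omega)]
    rfl
  have hzero : ∑ t ∈ tetra n, ∑ w ∈ Finset.Icc 1 n,
      (f t.1 t.2.1 t.2.2 (w + 1) - f t.1 t.2.1 t.2.2 w) = 0 := by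
    rw [sum_tetra_sum_Icc n fun a b c w => f a b c (w + 1) - f a b c w]
    · refine Finset.sum_eq_zero fun q hq => ?_
      obtain ⟨ha, hab, hbc, hcd, hd⟩ := mem_quads.1 hq
      linarith [hD.sum_ell_stage_succ ha hab hbc hcd hd]
    · intro a b c w hab hbc hw
      simp only [f, stage_succ hab hbc hw, sub_self]
  rw [Finset.sum_congr rfl htelescope, Finset.sum_sub_distrib, sub_eq_zero] at hzero
  exact hzero.symm

end IsPositiveFlag

/-! ### Plücker relations -/

section Enumeration

variable {ι : Type*} [LinearOrder ι]

theorem card_filter_lt_orderEmbOfFin {k : ℕ} (K : Finset ι) (hK : K.card = k) (i : Fin k) :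
    (K.filter (· < K.orderEmbOfFin hK i)).card = i := by
  have himage : K.filter (· < K.orderEmbOfFin hK i) =
      (Finset.Iio i).map (K.orderEmbOfFin hK).toEmbedding := by
    ext x
    simp only [Finset.mem_filter, Finset.mem_map, Finset.mem_Iio, RelEmbedding.coe_toEmbedding]
    constructor
    · rintro ⟨hx, hlt⟩
      obtain ⟨j, rfl⟩ : x ∈ Set.range (K.orderEmbOfFin hK) := by
        rwa [Finset.range_orderEmbOfFin]
      exact ⟨j, (K.orderEmbOfFin hK).lt_iff_lt.1 hlt, rfl⟩
    · rintro ⟨j, hj, rfl⟩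
      exact ⟨Finset.orderEmbOfFin_mem _ _ _, (K.orderEmbOfFin hK).lt_iff_lt.2 hj⟩
  rw [himage, Finset.card_map, Fin.card_Iio]

theorem orderEmbOfFin_erase {k : ℕ} (K : Finset ι) (hK : K.card = k + 1) (i : Fin (k + 1))
    (h : (K.erase (K.orderEmbOfFin hK i)).card = k) :
    ⇑((K.erase (K.orderEmbOfFin hK i)).orderEmbOfFin h) = K.orderEmbOfFin hK ∘ i.succAbove := by
  refine (Finset.orderEmbOfFin_unique h (fun j => ?_) ?_).symm
  · simp [Finset.orderEmbOfFin_mem, Fin.succAbove_ne]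
  · exact (K.orderEmbOfFin hK).strictMono.comp (Fin.strictMono_succAbove i)

end Enumeration

theorem card_insert_insert_of_notMem {ι : Type*} [DecidableEq ι] {I : Finset ι} {a b : ι}
    (hab : a ≠ b) (ha : a ∉ I) (hb : b ∉ I) : (insert a (insert b I)).card = I.card + 2 := by
  rw [Finset.card_insert_of_notMem (by simp [hab, ha]), Finset.card_insert_of_notMem hb]

section Plucker

variable {R : Type*} [CommRing R] {ι : Type*}

theorem sum_neg_one_pow_mul_mulVec_mul_det {k : ℕ} (A : Matrix (Fin (k + 1)) (Fin k) R)
    (w : Fin k → R) :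
    ∑ i : Fin (k + 1), (-1) ^ (i : ℕ) * (A.mulVec w i * (A.submatrix i.succAbove id).det) = 0 := by
  set B : Matrix (Fin (k + 1)) (Fin (k + 1)) R :=
    Matrix.of fun i => Fin.cons (A.mulVec w i) (A i)
  have hker : B.mulVec (Fin.cons (-1) w) = 0 := by
    ext i
    simp [B, Matrix.mulVec, dotProduct, Fin.sum_univ_succ]
  have hdet : B.det = 0 := by
    have h := congrFun (congrArg (fun N => N.mulVec (Fin.cons (-1) w)) B.adjugate_mul) 0
    simpa [← Matrix.mulVec_mulVec, hker, Matrix.smul_mulVec] using h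
  rw [Matrix.det_succ_column_zero] at hdet
  simp only [mul_assoc] at hdet
  exact hdet

theorem exists_mulVec_eq_det_cons {m : ℕ} (B : Matrix ι (Fin (m + 1)) R) (r : Fin m → ι) :
    ∃ w : Fin (m + 1) → R, ∀ x : ι,
      (B.submatrix (Fin.cons x r : Fin (m + 1) → ι) id).det = B.mulVec w x := by
  refine ⟨fun j => (-1) ^ (j : ℕ) * (B.submatrix r j.succAbove).det, fun x => ?_⟩
  rw [Matrix.det_succ_row_zero]
  simp only [Matrix.mulVec, dotProduct]
  refine Finset.sum_congr rfl fun j _ => ?_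
  have hsub : (B.submatrix (Fin.cons x r : Fin (m + 1) → ι) id).submatrix Fin.succ j.succAbove =
      B.submatrix r j.succAbove := by
    ext p q
    simp
  rw [hsub, Matrix.submatrix_apply, Fin.cons_zero, id]
  ring

theorem det_submatrix_insertNth {m : ℕ} (A : Matrix ι (Fin (m + 1)) R) (p : Fin (m + 1)) (x : ι)
    (r : Fin m → ι) :
    (A.submatrix (p.insertNth x r : Fin (m + 1) → ι) id).det =
      (-1) ^ (p : ℕ) * (A.submatrix (Fin.cons x r : Fin (m + 1) → ι) id).det := by
  rw [← Fin.cons_comp_cycleRange]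
  simpa using Matrix.det_permute p.cycleRange (A.submatrix (Fin.cons x r : Fin (m + 1) → ι) id)

variable [LinearOrder ι]

/-- The Plücker coordinate `I` of a matrix with `k` columns: the minor with rows `I` and all
columns. It is `0` when `I` does not have `k` elements. -/
def maximalMinor {k : ℕ} (A : Matrix ι (Fin k) R) (I : Finset ι) : R :=
  if h : I.card = k then (A.submatrix (I.orderEmbOfFin h) id).det else 0

theorem maximalMinor_of_card {k : ℕ} (A : Matrix ι (Fin k) R) {I : Finset ι} (h : I.card = k) :
    maximalMinor A I = (A.submatrix (I.orderEmbOfFin h) id).det :=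
  dif_pos h

theorem maximalMinor_insert_of_mem {m : ℕ} (A : Matrix ι (Fin (m + 1)) R) {I : Finset ι}
    (hI : I.card = m) {x : ι} (hx : x ∈ I) : maximalMinor A (insert x I) = 0 := by
  rw [Finset.insert_eq_of_mem hx]
  exact dif_neg (by omega)

theorem maximalMinor_insert {m : ℕ} (A : Matrix ι (Fin (m + 1)) R) {I : Finset ι}
    (hI : I.card = m) (x : ι) :
    maximalMinor A (insert x I) = (-1) ^ (I.filter (· < x)).card *
      (A.submatrix (Fin.cons x (I.orderEmbOfFin hI) : Fin (m + 1) → ι) id).det := by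
  by_cases hx : x ∈ I
  · obtain ⟨j, hj⟩ : x ∈ Set.range (I.orderEmbOfFin hI) := by
      rwa [Finset.range_orderEmbOfFin]
    rw [maximalMinor_insert_of_mem A hI hx, Matrix.det_zero_of_row_eq (Fin.succ_ne_zero j).symm,
      mul_zero]
    ext q
    simp [hj]
  have hcard : (insert x I).card = m + 1 := by rw [Finset.card_insert_of_notMem hx, hI]
  obtain ⟨p, hp⟩ : x ∈ Set.range ((insert x I).orderEmbOfFin hcard) := by
    rw [Finset.range_orderEmbOfFin]
    exact Finset.mem_insert_self x I
  have hsign : (I.filter (· < x)).card = p := by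
    rw [← card_filter_lt_orderEmbOfFin _ hcard p, hp, Finset.filter_insert, if_neg (lt_irrefl x)]
  have herase : (insert x I).erase ((insert x I).orderEmbOfFin hcard p) = I := by
    rw [hp, Finset.erase_insert hx]
  have hrest := orderEmbOfFin_erase (insert x I) hcard p (by rw [herase, hI])
  simp only [herase] at hrest
  have hrows : ⇑((insert x I).orderEmbOfFin hcard) = p.insertNth x (I.orderEmbOfFin hI) := by
    refine (Fin.insertNth_self_removeNth p _).symm.trans ?_
    rw [hp, hrest]
    rfl
  rw [maximalMinor_of_card A hcard, hrows, det_submatrix_insertNth, hsign]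

/- For a column vector `w`, adjoining the column `A w` to `A` keeps its columns dependent; expanding
along that column gives the relation, `A w` being chosen to list minors of `A * C` with rows `I`
and one further row. -/
theorem sum_maximalMinor_mul_maximalMinor {k m : ℕ} (A : Matrix ι (Fin k) R)
    (C : Matrix (Fin k) (Fin (m + 1)) R) {I K : Finset ι} (hI : I.card = m) (hK : K.card = k + 1) :
    ∑ x ∈ K, (-1) ^ ((K.filter (· < x)).card + (I.filter (· < x)).card) *
      (maximalMinor (A * C) (insert x I) * maximalMinor A (K.erase x)) = 0 := by
  obtain ⟨w, hw⟩ := exists_mulVec_eq_det_cons (A * C) (I.orderEmbOfFin hI)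
  set e := K.orderEmbOfFin hK
  have hterm : ∀ i : Fin (k + 1),
      (-1) ^ ((K.filter (· < e i)).card + (I.filter (· < e i)).card) *
        (maximalMinor (A * C) (insert (e i) I) * maximalMinor A (K.erase (e i))) =
      (-1) ^ (i : ℕ) * ((A.submatrix e id).mulVec (C.mulVec w) i *
        ((A.submatrix e id).submatrix i.succAbove id).det) := by
    intro i
    have hcard : (K.erase (e i)).card = k := by
      rw [Finset.card_erase_of_mem (Finset.orderEmbOfFin_mem _ _ _), hK, Nat.add_sub_cancel]
    have hentry : (A.submatrix e id).mulVec (C.mulVec w) i = (A * C).mulVec w (e i) := by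
      rw [← Matrix.mulVec_mulVec]
      rfl
    rw [card_filter_lt_orderEmbOfFin, maximalMinor_insert (A * C) hI, hw,
      maximalMinor_of_card A hcard, orderEmbOfFin_erase, hentry, Matrix.submatrix_submatrix,
      Function.id_comp, mul_assoc ((-1) ^ _), ← mul_assoc ((-1) ^ _), ← pow_add, add_assoc,
      pow_add _ (i : ℕ), Even.neg_one_pow ⟨_, rfl⟩, mul_one]
  rw [← sum_neg_one_pow_mul_mulVec_mul_det (A.submatrix e id) (C.mulVec w),
    ← Finset.sum_congr rfl fun i _ => hterm i, ← Finset.map_orderEmbOfFin_univ K hK, Finset.sum_map]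
  rfl

theorem maximalMinor_three_term {m : ℕ} (A : Matrix ι (Fin (m + 2)) R)
    (C : Matrix (Fin (m + 2)) (Fin (m + 1)) R) {I : Finset ι} (hI : I.card = m) {a b c : ι}
    (hab : a < b) (hbc : b < c) (ha : a ∉ I) (hb : b ∉ I) (hc : c ∉ I) :
    maximalMinor A (insert a (insert c I)) * maximalMinor (A * C) (insert b I) =
      maximalMinor A (insert a (insert b I)) * maximalMinor (A * C) (insert c I) +
        maximalMinor A (insert b (insert c I)) * maximalMinor (A * C) (insert a I) := by
  have hac := hab.trans hbc
  have haK : a ∉ insert b (insert c I) := by simp [hab.ne, hac.ne, ha]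
  have hbK : b ∉ insert c I := by simp [hbc.ne, hb]
  set K := insert a (insert b (insert c I)) with hK
  have hcard : K.card = m + 2 + 1 := by
    rw [hK, Finset.card_insert_of_notMem haK, Finset.card_insert_of_notMem hbK,
      Finset.card_insert_of_notMem hc, hI]
  have hrank_a : (K.filter (· < a)).card = (I.filter (· < a)).card + 0 := by
    simp [K, Finset.filter_insert, hab.not_gt, hac.not_gt]
  have hrank_b : (K.filter (· < b)).card = (I.filter (· < b)).card + 1 := by
    simp [K, Finset.filter_insert, hab, hbc.not_gt, ha]
  have hrank_c : (K.filter (· < c)).card = (I.filter (· < c)).card + 2 := by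
    simp [K, Finset.filter_insert, hac, hbc, ha, hb, hab.ne]
  have herase_a : K.erase a = insert b (insert c I) := Finset.erase_insert haK
  have herase_b : K.erase b = insert a (insert c I) := by
    rw [hK, Finset.erase_insert_of_ne hab.ne, Finset.erase_insert hbK]
  have herase_c : K.erase c = insert a (insert b I) := by
    rw [hK, Finset.erase_insert_of_ne hac.ne, Finset.erase_insert_of_ne hbc.ne,
      Finset.erase_insert hc]
  have hsign : ∀ p j : ℕ, (-1 : R) ^ (p + j + p) = (-1) ^ j := fun p j => by
    rw [add_right_comm, pow_add, Even.neg_one_pow ⟨p, rfl⟩, one_mul]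
  have hrel := sum_maximalMinor_mul_maximalMinor A C hI hcard
  rw [Finset.sum_insert haK, Finset.sum_insert hbK, Finset.sum_insert hc,
    Finset.sum_eq_zero fun x hx => by rw [maximalMinor_insert_of_mem _ hI hx, zero_mul, mul_zero],
    herase_a, herase_b, herase_c, hrank_a, hrank_b, hrank_c, hsign, hsign, hsign] at hrel
  linear_combination -hrel

end Plucker

/-! ### Flag minors -/

theorem val_firstEmb {k n : ℕ} (h : k ≤ n) (j : Fin k) : (firstEmb h j : ℕ) = j := rfl

theorem val_lastEmb {k n : ℕ} (h : k ≤ n) (j : Fin k) : (lastEmb h j : ℕ) = n - k + j := rfl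

theorem maximalMinor_submatrix_eq_rightMinor {n k : ℕ} (M : Matrix (Fin n) (Fin n) ℝ)
    {I : Finset (Fin n)} (hI : I.card = k) (hk : k ≤ n) :
    maximalMinor (M.submatrix id (lastEmb hk)) I = rightMinor M I := by
  subst hI
  exact maximalMinor_of_card _ rfl

theorem maximalMinor_submatrix_eq_upperMinor {n k : ℕ} (M : Matrix (Fin n) (Fin n) ℝ)
    {I : Finset (Fin n)} (hI : I.card = k) (hk : k ≤ n) :
    maximalMinor (M.transpose.submatrix id (firstEmb hk)) I = upperMinor M I := by
  subst hI
  rw [maximalMinor_of_card _ rfl, upperMinor, minor, ← Matrix.det_transpose]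
  rfl

section ThreeTerm

variable {n : ℕ} {I : Finset (Fin n)} {a b c : Fin n}

theorem card_add_two_le (hab : a ≠ b) (ha : a ∉ I) (hb : b ∉ I) : I.card + 2 ≤ n := by
  rw [← card_insert_insert_of_notMem hab ha hb]
  exact card_le _

theorem three_term_of_maximalMinor {m : ℕ} (f : Finset (Fin n) → ℝ)
    (A : Matrix (Fin n) (Fin (m + 2)) ℝ) (s : Fin (m + 1) → Fin (m + 2))
    (h₁ : ∀ J : Finset (Fin n), J.card = m + 1 → maximalMinor (A.submatrix id s) J = f J)
    (h₂ : ∀ J : Finset (Fin n), J.card = m + 2 → maximalMinor A J = f J)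
    (hI : I.card = m) (hab : a < b) (hbc : b < c) (ha : a ∉ I) (hb : b ∉ I) (hc : c ∉ I) :
    f (insert a (insert c I)) * f (insert b I) =
      f (insert a (insert b I)) * f (insert c I) + f (insert b (insert c I)) * f (insert a I) := by
  have hmul : A * (1 : Matrix (Fin (m + 2)) (Fin (m + 2)) ℝ).submatrix id s =
      A.submatrix id s := by
    ext i j
    simp [Matrix.mul_apply, Matrix.one_apply]
  have h := maximalMinor_three_term A (Matrix.submatrix 1 id s) hI hab hbc ha hb hc
  rwa [hmul, h₁ _ (by rw [Finset.card_insert_of_notMem hb, hI]),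
    h₁ _ (by rw [Finset.card_insert_of_notMem hc, hI]),
    h₁ _ (by rw [Finset.card_insert_of_notMem ha, hI]),
    h₂ _ (by rw [card_insert_insert_of_notMem (hab.trans hbc).ne ha hc, hI]),
    h₂ _ (by rw [card_insert_insert_of_notMem hab.ne ha hb, hI]),
    h₂ _ (by rw [card_insert_insert_of_notMem hbc.ne hb hc, hI])] at h

theorem rightMinor_three_term (M : Matrix (Fin n) (Fin n) ℝ) (hab : a < b) (hbc : b < c)
    (ha : a ∉ I) (hb : b ∉ I) (hc : c ∉ I) :
    rightMinor M (insert a (insert c I)) * rightMinor M (insert b I) =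
      rightMinor M (insert a (insert b I)) * rightMinor M (insert c I) +
        rightMinor M (insert b (insert c I)) * rightMinor M (insert a I) := by
  have hn := card_add_two_le hab.ne ha hb
  have hcols : ⇑(lastEmb hn) ∘ Fin.succ = lastEmb (Nat.le_of_succ_le hn) := by
    ext j
    rw [Function.comp_apply, val_lastEmb, val_lastEmb, Fin.val_succ]
    omega
  refine three_term_of_maximalMinor (rightMinor M) (M.submatrix id (lastEmb hn)) Fin.succ
    (fun J hJ => ?_) (fun J hJ => maximalMinor_submatrix_eq_rightMinor M hJ hn) rfl hab hbc ha hb hc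
  rw [Matrix.submatrix_submatrix, hcols]
  exact maximalMinor_submatrix_eq_rightMinor M hJ _

theorem upperMinor_three_term (M : Matrix (Fin n) (Fin n) ℝ) (hab : a < b) (hbc : b < c)
    (ha : a ∉ I) (hb : b ∉ I) (hc : c ∉ I) :
    upperMinor M (insert a (insert c I)) * upperMinor M (insert b I) =
      upperMinor M (insert a (insert b I)) * upperMinor M (insert c I) +
        upperMinor M (insert b (insert c I)) * upperMinor M (insert a I) := by
  have hn := card_add_two_le hab.ne ha hb
  exact three_term_of_maximalMinor (upperMinor M) (M.transpose.submatrix id (firstEmb hn))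
    Fin.castSucc (fun J hJ => maximalMinor_submatrix_eq_upperMinor M hJ (Nat.le_of_succ_le hn))
    (fun J hJ => maximalMinor_submatrix_eq_upperMinor M hJ hn) rfl hab hbc ha hb hc

end ThreeTerm

theorem isInvUpper_of_diag_ne_zero {n : ℕ} {H : Matrix (Fin n) (Fin n) ℝ}
    (hupper : ∀ i j, j < i → H i j = 0) (hdiag : ∀ i, H i i ≠ 0) : IsInvUpper H := by
  refine ⟨hupper, ?_⟩
  rw [Matrix.det_of_isUpperTriangular (fun i j => hupper i j), isUnit_iff_ne_zero]
  exact Finset.prod_ne_zero_iff.2 fun i _ => hdiag i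

/- Adding a large multiple of the partial permutation matrix `r t ↦ c t` to the identity makes the
minor with rows `r` and columns `c` strictly diagonally dominant. -/
theorem not_vanishesIdentically {n k : ℕ} (r c : Fin k ↪o Fin n) (h : ∀ t, r t ≤ c t) :
    ¬ VanishesIdentically r c := by
  classical
  intro hvanish
  set H : Matrix (Fin n) (Fin n) ℝ := Matrix.of fun i j =>
    (1 : Matrix (Fin n) (Fin n) ℝ) i j + if ∃ t, r t = i ∧ c t = j then (k : ℝ) + 1 else 0 with hH
  have hupper : ∀ i j, j < i → H i j = 0 := by
    intro i j hji
    have hij : ¬ ∃ t, r t = i ∧ c t = j := by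
      rintro ⟨t, rfl, rfl⟩
      exact (h t).not_gt hji
    simp [hH, hij, Matrix.one_apply_ne hji.ne']
  have hdiag : ∀ i, H i i ≠ 0 := by
    intro i
    simp only [hH, Matrix.of_apply, Matrix.one_apply_eq]
    split_ifs <;> positivity
  refine det_ne_zero_of_sum_row_lt_diag (fun i => ?_)
    (hvanish H (isInvUpper_of_diag_ne_zero hupper hdiag))
  have hoff : ∀ j ∈ Finset.univ.erase i, ‖H.submatrix r c i j‖ ≤ 1 := by
    intro j hj
    have hij : ¬ ∃ t, r t = r i ∧ c t = c j := by
      rintro ⟨t, hr, hc⟩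
      exact Finset.ne_of_mem_erase hj ((c.injective hc).symm.trans (r.injective hr))
    simp only [hH, Matrix.submatrix_apply, Matrix.of_apply, if_neg hij, add_zero, Matrix.one_apply]
    split_ifs <;> simp
  have hon : (k : ℝ) + 1 ≤ ‖H.submatrix r c i i‖ := by
    have hii : ∃ t, r t = r i ∧ c t = c i := ⟨i, rfl, rfl⟩
    simp only [hH, Matrix.submatrix_apply, Matrix.of_apply, if_pos hii, Matrix.one_apply]
    refine le_trans ?_ (le_abs_self _)
    split_ifs <;> linarith
  calc ∑ j ∈ Finset.univ.erase i, ‖H.submatrix r c i j‖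
      ≤ ∑ _j ∈ Finset.univ.erase i, (1 : ℝ) := Finset.sum_le_sum hoff
    _ ≤ k := by simp
    _ < ‖H.submatrix r c i i‖ := by linarith

section TotallyPositive

variable {n : ℕ} {M : Matrix (Fin n) (Fin n) ℝ}

theorem IsTotallyPositive.rightMinor_pos (hM : IsTotallyPositive M) (I : Finset (Fin n)) :
    0 < rightMinor M I := by
  refine hM.2 _ _ _ (not_vanishesIdentically _ _ fun i => ?_)
  have hrank := card_filter_lt_orderEmbOfFin I rfl i
  have hcompl : (I.filter fun x => ¬ x < I.orderEmbOfFin rfl i).card ≤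
      (Finset.Ici (I.orderEmbOfFin rfl i)).card :=
    Finset.card_le_card fun x => by simp
  have hsplit := Finset.card_filter_add_card_filter_not (s := I) (· < I.orderEmbOfFin rfl i)
  rw [Fin.card_Ici] at hcompl
  rw [Fin.le_def, val_lastEmb]
  omega

theorem IsTotallyPositive.upperMinor_pos (hM : IsTotallyPositive M) (I : Finset (Fin n)) :
    0 < upperMinor M I := by
  refine hM.2 _ _ _ (not_vanishesIdentically _ _ fun i => ?_)
  rw [Fin.le_def, val_firstEmb, ← card_filter_lt_orderEmbOfFin I rfl i, ← Fin.card_Iio]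
  exact Finset.card_le_card fun x => by simp

end TotallyPositive

/-! ### The four families as cross ratios of flag minors -/

/-- The elements of `Fin n` whose label lies in `S`. -/
def labelled (n : ℕ) (S : Finset ℕ) : Finset (Fin n) :=
  Finset.univ.filter fun i => i.val + 1 ∈ S

theorem mem_labelled {n : ℕ} {S : Finset ℕ} {i : Fin n} : i ∈ labelled n S ↔ i.val + 1 ∈ S := by
  simp [labelled]

theorem mem_seg {n a b : ℕ} {i : Fin n} : i ∈ seg n a b ↔ a ≤ i.val + 1 ∧ i.val + 1 ≤ b := by
  simp [seg]

theorem labelled_insert_succ {n : ℕ} (S : Finset ℕ) (x : Fin n) :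
    labelled n (insert (x.val + 1) S) = insert x (labelled n S) := by
  ext i
  simp [mem_labelled, Fin.ext_iff]

theorem isPositiveFlag_labelled {n : ℕ} {f : Finset (Fin n) → ℝ} (hpos : ∀ I, 0 < f I)
    (hrel : ∀ {I : Finset (Fin n)} {a b c : Fin n}, a < b → b < c → a ∉ I → b ∉ I → c ∉ I →
      f (insert a (insert c I)) * f (insert b I) =
        f (insert a (insert b I)) * f (insert c I) +
          f (insert b (insert c I)) * f (insert a I)) :
    IsPositiveFlag n fun S => f (labelled n S) where
  pos _ := hpos _
  rel S a b c ha hab hbc hc haS hbS hcS := by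
    have hlabel : ∀ x, 1 ≤ x → x ≤ n → ∃ i : Fin n, x = i + 1 := fun x h₁ hn =>
      ⟨⟨x - 1, by omega⟩, by simp only; omega⟩
    obtain ⟨a, rfl⟩ := hlabel a ha (by omega)
    obtain ⟨b, rfl⟩ := hlabel b (by omega) (by omega)
    obtain ⟨c, rfl⟩ := hlabel c (by omega) hc
    simp only [labelled_insert_succ]
    rw [← mem_labelled] at haS hbS hcS
    exact hrel (by simpa using hab) (by simpa using hbc) haS hbS hcS

section CrossRatios

variable {n : ℕ} (M : Matrix (Fin n) (Fin n) ℝ) {a b c : ℕ}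

theorem YLow_eq_crossY (hab : a < b) (hbc : b < c) :
    YLow M a b c = crossY (fun S => rightMinor M (labelled n S))
      (Finset.Ioo a b ∪ Finset.Ioc c n) a b c := by
  unfold YLow crossY
  congr 3 <;> ext i <;> grind [mem_labelled, mem_seg]

theorem YTildeLow_eq_crossY (ha : 1 ≤ a) (hab : a < b) (hbc : b < c) :
    YTildeLow M a b c = crossY (fun S => rightMinor M (labelled n S))
      (Finset.Ico 1 a ∪ Finset.Ioo b c) a b c := by
  unfold YTildeLow crossY
  congr 3 <;> ext i <;> grind [mem_labelled, mem_seg]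

theorem YUp_eq_inv_crossY (hab : a < b) (hbc : b < c) :
    YUp M a b c = (crossY (fun S => upperMinor M (labelled n S))
      (Finset.Ioo a b ∪ Finset.Ioc c n) a b c)⁻¹ := by
  unfold YUp crossY
  rw [inv_div]
  congr 3 <;> ext i <;> grind [mem_labelled, mem_seg]

theorem YTildeUp_eq_inv_crossY (ha : 1 ≤ a) (hab : a < b) (hbc : b < c) :
    YTildeUp M a b c = (crossY (fun S => upperMinor M (labelled n S))
      (Finset.Ico 1 a ∪ Finset.Ioo b c) a b c)⁻¹ := by
  unfold YTildeUp crossY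
  rw [inv_div]
  congr 3 <;> ext i <;> grind [mem_labelled, mem_seg]

end CrossRatios

/-! ### Solid minors of an upper triangular matrix -/

/-- The increasing enumeration of the interval `{p, …, p + k - 1}` of `Fin n`. -/
def intervalEmb {k n : ℕ} (p : ℕ) (h : p + k ≤ n) : Fin k ↪o Fin n :=
  OrderEmbedding.ofStrictMono (fun j => ⟨p + j, by omega⟩) fun _ _ hij => Nat.add_lt_add_left hij p

theorem val_intervalEmb {k n p : ℕ} (h : p + k ≤ n) (j : Fin k) :
    (intervalEmb p h j : ℕ) = p + j := rfl

theorem map_intervalEmb {k n p : ℕ} (h : p + k ≤ n) :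
    Finset.univ.map (intervalEmb p h).toEmbedding = seg n (p + 1) (p + k) := by
  ext x
  simp only [Finset.mem_map, Finset.mem_univ, true_and, mem_seg, RelEmbedding.coe_toEmbedding,
    Fin.ext_iff, val_intervalEmb]
  exact ⟨by rintro ⟨j, hj⟩; omega, fun hx => ⟨⟨x - p, by omega⟩, by simp only; omega⟩⟩

theorem map_firstEmb {k n : ℕ} (h : k ≤ n) :
    Finset.univ.map (firstEmb h).toEmbedding = seg n 1 k := by
  ext x
  simp only [Finset.mem_map, Finset.mem_univ, true_and, mem_seg, RelEmbedding.coe_toEmbedding,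
    Fin.ext_iff, val_firstEmb]
  exact ⟨by rintro ⟨j, hj⟩; omega, fun hx => ⟨⟨x, by omega⟩, rfl⟩⟩

theorem map_lastEmb {k n : ℕ} (h : k ≤ n) :
    Finset.univ.map (lastEmb h).toEmbedding = seg n (n - k + 1) n := by
  ext x
  simp only [Finset.mem_map, Finset.mem_univ, true_and, mem_seg, RelEmbedding.coe_toEmbedding,
    Fin.ext_iff, val_lastEmb]
  exact ⟨by rintro ⟨j, hj⟩; omega, fun hx => ⟨⟨x - (n - k), by omega⟩, by simp only; omega⟩⟩

theorem firstEmb_lt_intervalEmb {k l n p : ℕ} (hk : k ≤ n) (hl : p + l ≤ n) (hkp : k ≤ p)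
    (i : Fin k) (j : Fin l) : firstEmb hk i < intervalEmb p hl j := by
  rw [Fin.lt_def, val_firstEmb, val_intervalEmb]
  omega

theorem intervalEmb_lt_lastEmb {k l n p : ℕ} (hk : p + k ≤ n) (hl : l ≤ n) (hkl : p + k + l ≤ n)
    (i : Fin k) (j : Fin l) : intervalEmb p hk i < lastEmb hl j := by
  rw [Fin.lt_def, val_intervalEmb, val_lastEmb]
  omega

section Append

variable {α : Type*} [LinearOrder α] {k l : ℕ}

/-- The concatenation of two increasing sequences, all terms of the first lying below those of the
second. -/
def appendEmb (f : Fin k ↪o α) (g : Fin l ↪o α) (h : ∀ i j, f i < g j) : Fin (k + l) ↪o α :=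
  OrderEmbedding.ofStrictMono (Fin.append f g) fun i j => by
    refine Fin.addCases (fun i => ?_) (fun i => ?_) i <;>
      refine Fin.addCases (fun j => ?_) (fun j => ?_) j <;> intro hij
    · rw [Fin.append_left, Fin.append_left]
      exact f.strictMono hij
    · rw [Fin.append_left, Fin.append_right]
      exact h i j
    · rw [Fin.lt_def, Fin.val_natAdd, Fin.val_castAdd] at hij
      omega
    · rw [Fin.append_right, Fin.append_right]
      exact g.strictMono ((Fin.natAdd_lt_natAdd_iff k).1 hij)

variable {f : Fin k ↪o α} {g : Fin l ↪o α} (h : ∀ i j, f i < g j)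

theorem appendEmb_castAdd (i : Fin k) : appendEmb f g h (Fin.castAdd l i) = f i :=
  Fin.append_left f g i

theorem appendEmb_natAdd (j : Fin l) : appendEmb f g h (Fin.natAdd k j) = g j :=
  Fin.append_right f g j

theorem map_appendEmb : Finset.univ.map (appendEmb f g h).toEmbedding =
    Finset.univ.map f.toEmbedding ∪ Finset.univ.map g.toEmbedding := by
  ext x
  simp only [Finset.mem_map, Finset.mem_union, Finset.mem_univ, true_and,
    RelEmbedding.coe_toEmbedding, finSumFinEquiv.surjective.exists, Sum.exists,
    finSumFinEquiv_apply_left, finSumFinEquiv_apply_right, appendEmb_castAdd, appendEmb_natAdd]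

end Append

theorem firstEmb_add {k l n : ℕ} (h : k + l ≤ n) :
    firstEmb h = appendEmb (firstEmb (by omega)) (intervalEmb k h)
      (firstEmb_lt_intervalEmb _ _ le_rfl) := by
  ext i
  refine Fin.addCases (fun i => ?_) (fun i => ?_) i
  · rw [appendEmb_castAdd, val_firstEmb, val_firstEmb, Fin.val_castAdd]
  · rw [appendEmb_natAdd, val_firstEmb, val_intervalEmb, Fin.val_natAdd]

theorem lastEmb_add {k l n p : ℕ} (h : p + k + l = n) :
    lastEmb (by omega : k + l ≤ n) = appendEmb (intervalEmb p (by omega)) (lastEmb (by omega))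
      (intervalEmb_lt_lastEmb _ _ h.le) := by
  ext i
  refine Fin.addCases (fun i => ?_) (fun i => ?_) i
  · rw [appendEmb_castAdd, val_lastEmb, val_intervalEmb, Fin.val_castAdd]
    omega
  · rw [appendEmb_natAdd, val_lastEmb, val_lastEmb, Fin.val_natAdd]
    omega

section Minors

variable {n k l : ℕ} (M : Matrix (Fin n) (Fin n) ℝ)

theorem minor_appendEmb {r₁ c₁ : Fin k ↪o Fin n} {r₂ c₂ : Fin l ↪o Fin n}
    (hr : ∀ i j, r₁ i < r₂ j) (hc : ∀ i j, c₁ i < c₂ j) (h : ∀ i j, M (r₂ i) (c₁ j) = 0) :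
    minor M (appendEmb r₁ r₂ hr) (appendEmb c₁ c₂ hc) = minor M r₁ c₁ * minor M r₂ c₂ := by
  simp only [minor]
  rw [← Matrix.det_fromBlocks_zero₂₁ _ (M.submatrix r₁ c₂),
    ← Matrix.det_submatrix_equiv_self finSumFinEquiv]
  congr 1
  ext (i | i) (j | j) <;> simp [appendEmb_castAdd, appendEmb_natAdd, h]

theorem rightMinor_map (f : Fin k ↪o Fin n) (hk : k ≤ n) :
    rightMinor M (Finset.univ.map f.toEmbedding) = minor M f (lastEmb hk) := by
  have hcard : (Finset.univ.map f.toEmbedding).card = k := by simp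
  rw [← maximalMinor_submatrix_eq_rightMinor M hcard hk, maximalMinor_of_card _ hcard,
    ← Finset.orderEmbOfFin_unique' hcard (f := f) (by simp)]
  rfl

theorem upperMinor_map (f : Fin k ↪o Fin n) (hk : k ≤ n) :
    upperMinor M (Finset.univ.map f.toEmbedding) = minor M (firstEmb hk) f := by
  have hcard : (Finset.univ.map f.toEmbedding).card = k := by simp
  rw [← maximalMinor_submatrix_eq_upperMinor M hcard hk, maximalMinor_of_card _ hcard,
    ← Finset.orderEmbOfFin_unique' hcard (f := f) (by simp), minor, ← Matrix.det_transpose]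
  rfl

theorem rightMinor_interval_union {M : Matrix (Fin n) (Fin n) ℝ} (hM : ∀ i j, j < i → M i j = 0)
    {p q : ℕ} (hpq : p ≤ q) (hq : q + k + l = n) :
    rightMinor M (seg n (p + 1) (p + k) ∪ seg n (q + k + 1) n) =
      minor M (intervalEmb (k := k) p (by omega)) (intervalEmb q (by omega)) *
        rightMinor M (seg n (q + k + 1) n) := by
  have hl : l ≤ n := by omega
  have htail : seg n (q + k + 1) n = Finset.univ.map (lastEmb hl).toEmbedding := by
    rw [map_lastEmb, ← hq, Nat.add_sub_cancel]
  rw [htail, ← map_intervalEmb (by omega),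
    ← map_appendEmb (intervalEmb_lt_lastEmb _ hl (by omega)), rightMinor_map M _ (by omega),
    rightMinor_map M _ hl, lastEmb_add hq, minor_appendEmb]
  exact fun i j => hM _ _ (intervalEmb_lt_lastEmb _ hl hq.le j i)

theorem upperMinor_union_interval {M : Matrix (Fin n) (Fin n) ℝ} (hM : ∀ i j, j < i → M i j = 0)
    {p q : ℕ} (hpq : p ≤ q) (hq : q + k ≤ n) :
    upperMinor M (seg n 1 p ∪ seg n (q + 1) (q + k)) =
      upperMinor M (seg n 1 p) * minor M (intervalEmb p (by omega)) (intervalEmb q hq) := by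
  have hp : p ≤ n := by omega
  rw [← map_firstEmb hp, ← map_intervalEmb hq, ← map_appendEmb (firstEmb_lt_intervalEmb hp hq hpq),
    upperMinor_map M _ (by omega), upperMinor_map M _ hp, firstEmb_add, minor_appendEmb]
  exact fun i j => hM _ _ (firstEmb_lt_intervalEmb hp _ le_rfl j i)

end Minors

theorem rightMinor_mul_upperMinor {n : ℕ} {M : Matrix (Fin n) (Fin n) ℝ}
    (hM : ∀ i j, j < i → M i j = 0) {a b c : ℕ} (ha : 1 ≤ a) (hab : a ≤ b + 1) (hbc : b ≤ c)
    (hc : c ≤ n) :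
    rightMinor M (seg n a b ∪ seg n (c + 1) n) * upperMinor M (seg n 1 (a - 1)) =
      upperMinor M (seg n 1 (a - 1) ∪ seg n (a + c - b) c) * rightMinor M (seg n (c + 1) n) := by
  obtain ⟨p, rfl⟩ : ∃ p, a = p + 1 := ⟨a - 1, by omega⟩
  obtain ⟨k, rfl⟩ : ∃ k, b = p + k := ⟨b - p, by omega⟩
  obtain ⟨q, rfl⟩ : ∃ q, c = q + k := ⟨c - k, by omega⟩
  obtain ⟨l, rfl⟩ : ∃ l, n = q + k + l := ⟨n - (q + k), by omega⟩
  have hcol : p + 1 + (q + k) - (p + k) = q + 1 := by omega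
  rw [hcol, Nat.add_sub_cancel, rightMinor_interval_union hM (by omega) rfl,
    upperMinor_union_interval hM (by omega) hc]
  ring

theorem IsTotallyPositive.YLow_eq_YTildeUp {n : ℕ} {M : Matrix (Fin n) (Fin n) ℝ}
    (hM : IsTotallyPositive M) {a b c : ℕ} (ha : 1 ≤ a) (hab : a < b) (hbc : b < c) (hc : c ≤ n) :
    YLow M a b c = YTildeUp M a (a + c - b) c := by
  have hr : ∀ I, rightMinor M I ≠ 0 := fun I => (hM.rightMinor_pos I).ne'
  have hu : ∀ J, upperMinor M J ≠ 0 := fun J => (hM.upperMinor_pos J).ne'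
  have hzero := hM.1.1
  have hcol₁ : a + c - (b - 1) = a + c - b + 1 := by omega
  have hcol₂ : a + 1 + (c - 1) - b = a + c - b := by omega
  have hcol₃ : a + 1 + (c - 1) - (b - 1) = a + c - b + 1 := by omega
  have hc₁ : c - 1 + 1 = c := by omega
  have h₁ := eq_div_of_mul_eq (hu _)
    (rightMinor_mul_upperMinor hzero ha (b := b - 1) (by omega) (by omega) hc)
  have h₂ := eq_div_of_mul_eq (hu _) (rightMinor_mul_upperMinor hzero (a := a + 1) (b := b)
    (c := c - 1) (by omega) (by omega) (by omega) (by omega))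
  have h₃ := eq_div_of_mul_eq (hu _) (rightMinor_mul_upperMinor hzero ha hab.le.step hbc.le hc)
  have h₄ := eq_div_of_mul_eq (hu _) (rightMinor_mul_upperMinor hzero (a := a + 1) (b := b - 1)
    (c := c - 1) (by omega) (by omega) (by omega) (by omega))
  rw [hcol₁] at h₁
  rw [hcol₂, hc₁, Nat.add_sub_cancel] at h₂
  rw [hcol₃, hc₁, Nat.add_sub_cancel] at h₄
  rw [YLow, YTildeUp, h₁, h₂, h₃, h₄]
  field_simp [hr, hu]

/-! ### The dilogarithm sums -/

namespace IsTotallyPositive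

variable {n : ℕ} {M : Matrix (Fin n) (Fin n) ℝ}

theorem isPositiveFlag_rightMinor (hM : IsTotallyPositive M) :
    IsPositiveFlag n fun S => rightMinor M (labelled n S) :=
  isPositiveFlag_labelled hM.rightMinor_pos (rightMinor_three_term M)

theorem isPositiveFlag_upperMinor (hM : IsTotallyPositive M) :
    IsPositiveFlag n fun S => upperMinor M (labelled n S) :=
  isPositiveFlag_labelled hM.upperMinor_pos (upperMinor_three_term M)

theorem sum_ell_YLow_eq_YTildeLow (hM : IsTotallyPositive M) :
    ∑ t ∈ tetra n, ell (YLow M t.1 t.2.1 t.2.2) =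
      ∑ t ∈ tetra n, ell (YTildeLow M t.1 t.2.1 t.2.2) := by
  refine Eq.trans ?_ (hM.isPositiveFlag_rightMinor.sum_ell_crossY.trans ?_) <;>
    refine Finset.sum_congr rfl fun t ht => ?_ <;>
    obtain ⟨ha, hab, hbc, -⟩ := mem_tetra.1 ht
  · rw [YLow_eq_crossY M hab hbc]
  · rw [YTildeLow_eq_crossY M ha hab hbc]

theorem sum_ell_YUp_eq_YTildeUp (hM : IsTotallyPositive M) :
    ∑ t ∈ tetra n, ell (YUp M t.1 t.2.1 t.2.2) =
      ∑ t ∈ tetra n, ell (YTildeUp M t.1 t.2.1 t.2.2) := by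
  have hD := hM.isPositiveFlag_upperMinor
  have hinv : ∀ S a b c, ell (crossY _ S a b c)⁻¹ = 2 * ell 1 - ell (crossY _ S a b c) :=
    fun S a b c => eq_sub_of_add_eq' (ell_add_ell_inv (hD.crossY_pos S a b c))
  have hsum := congrArg (fun s => ∑ t ∈ tetra n, 2 * ell 1 - s) hD.sum_ell_crossY
  simp only [← Finset.sum_sub_distrib, ← hinv] at hsum
  refine Eq.trans ?_ (hsum.trans ?_) <;> refine Finset.sum_congr rfl fun t ht => ?_ <;>
    obtain ⟨ha, hab, hbc, -⟩ := mem_tetra.1 ht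
  · rw [YUp_eq_inv_crossY M hab hbc]
  · rw [YTildeUp_eq_inv_crossY M ha hab hbc]

theorem sum_ell_YLow_eq_YTildeUp (hM : IsTotallyPositive M) :
    ∑ t ∈ tetra n, ell (YLow M t.1 t.2.1 t.2.2) =
      ∑ t ∈ tetra n, ell (YTildeUp M t.1 t.2.1 t.2.2) := by
  refine Finset.sum_nbij' (fun t => (t.1, t.1 + t.2.2 - t.2.1, t.2.2))
    (fun t => (t.1, t.1 + t.2.2 - t.2.1, t.2.2)) ?_ ?_ ?_ ?_ fun t ht => ?_
  iterate 4 grind [mem_tetra]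
  obtain ⟨ha, hab, hbc, hc⟩ := mem_tetra.1 ht
  rw [hM.YLow_eq_YTildeUp ha hab hbc hc]

end IsTotallyPositive

end TPDilog

theorem proposition3p7_general (n : ℕ) (M : Matrix (Fin n) (Fin n) ℝ)
    (hM : TPDilog.IsTotallyPositive M) :
    (∀ a b c : ℕ, 1 ≤ a → a < b → b < c → c ≤ n →
      0 < TPDilog.YLow M a b c ∧ 0 < TPDilog.YTildeUp M a b c ∧
      0 < TPDilog.YTildeLow M a b c ∧ 0 < TPDilog.YUp M a b c) ∧
    ∑ t ∈ TPDilog.tetra n, TPDilog.ell (TPDilog.YLow M t.1 t.2.1 t.2.2) =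
      ∑ t ∈ TPDilog.tetra n, TPDilog.ell (TPDilog.YTildeUp M t.1 t.2.1 t.2.2) ∧
    ∑ t ∈ TPDilog.tetra n, TPDilog.ell (TPDilog.YTildeUp M t.1 t.2.1 t.2.2) =
      ∑ t ∈ TPDilog.tetra n, TPDilog.ell (TPDilog.YTildeLow M t.1 t.2.1 t.2.2) ∧
    ∑ t ∈ TPDilog.tetra n, TPDilog.ell (TPDilog.YTildeLow M t.1 t.2.1 t.2.2) =
      ∑ t ∈ TPDilog.tetra n, TPDilog.ell (TPDilog.YUp M t.1 t.2.1 t.2.2) := by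
  have hlow := hM.sum_ell_YLow_eq_YTildeLow
  have hup := hM.sum_ell_YUp_eq_YTildeUp
  have hmix := hM.sum_ell_YLow_eq_YTildeUp
  refine ⟨fun a b c ha hab hbc _ => ?_, hmix, hmix.symm.trans hlow,
    (hlow.symm.trans hmix).trans hup.symm⟩
  have hright := hM.isPositiveFlag_rightMinor.crossY_pos
  have hupper := hM.isPositiveFlag_upperMinor.crossY_pos
  rw [TPDilog.YLow_eq_crossY M hab hbc, TPDilog.YTildeUp_eq_inv_crossY M ha hab hbc,
    TPDilog.YTildeLow_eq_crossY M ha hab hbc, TPDilog.YUp_eq_inv_crossY M hab hbc]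
  exact ⟨hright _ _ _ _, inv_pos.2 (hupper _ _ _ _), hright _ _ _ _, inv_pos.2 (hupper _ _ _ _)⟩

theorem proposition3p7 (n : ℕ) (hn : 2 ≤ n) (M : Matrix (Fin n) (Fin n) ℝ)
    (hM : M ∈ TPDilog.NPlus n) :
    (∀ a b c : ℕ, 1 ≤ a → a < b → b < c → c ≤ n →
      0 < TPDilog.YLow M a b c ∧ 0 < TPDilog.YTildeUp M a b c ∧
      0 < TPDilog.YTildeLow M a b c ∧ 0 < TPDilog.YUp M a b c) ∧
    ∑ t ∈ TPDilog.tetra n, TPDilog.ell (TPDilog.YLow M t.1 t.2.1 t.2.2) =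
      ∑ t ∈ TPDilog.tetra n, TPDilog.ell (TPDilog.YTildeUp M t.1 t.2.1 t.2.2) ∧
    ∑ t ∈ TPDilog.tetra n, TPDilog.ell (TPDilog.YTildeUp M t.1 t.2.1 t.2.2) =
      ∑ t ∈ TPDilog.tetra n, TPDilog.ell (TPDilog.YTildeLow M t.1 t.2.1 t.2.2) ∧
    ∑ t ∈ TPDilog.tetra n, TPDilog.ell (TPDilog.YTildeLow M t.1 t.2.1 t.2.2) =
      ∑ t ∈ TPDilog.tetra n, TPDilog.ell (TPDilog.YUp M t.1 t.2.1 t.2.2) :=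
  proposition3p7_general n M hM.2
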